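/- Let $\mathcal P$ be a finite set of mutually independent random variables in a probability space, and let $\mathcal A$ be a finite set of events determined by these variables. An evaluation of the variables violates $A\in\mathcal A$ if it makes $A$ happen, and $\mathrm{vbl}(A)\subseteq\mathcal P$ denotes the unique minimal set of variables that determines $A$. Call $A,B\in\mathcal A$ lopsidependent if there are two evaluations $f,g$ of the variables in $\mathcal P$ that differ only on variables in $\mathrm{vbl}(A)\cap\mathrm{vbl}(B)$ such that $f$ violates $A$ and $g$ violates $B$, but either $f$ does not violate $B$ or $g$ does not violate $A$. Let $\Gamma'(A)$ be the set of all $B\in\mathcal A$ that are lopsidependent with $A$. Suppose that there is an assignment of reals $x:\mathcal A\to(0,1)$ such that $$\forall A\in\mathcal A:\quad \Pr[A]\;\le\; x(A)\prod_{B\in\Gamma'(A)}(1-x(B)).$$ Then there exists an assignment of values to the variables in $\mathcal P$ that violates none of the events in $\mathcal A$. Moreover, consider the following randomized algorithm: start with an independent random evaluation of all variables, each according to its distribution; while some event is violated, pick a violated event $A\in\mathcal A$ by an arbitrary fixed (deterministic or randomized) procedure and resample it, that is, give the variables in $\mathrm{vbl}(A)$ new independent random values according to their distributions and keep the values of all other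 variables. With probability $1$ this algorithm finds an evaluation that violates none of the events, and each event $A\in\mathcal A$ is resampled an expected number of at most $x(A)/(1-x(A))$ times before that. Thus the expected total number of resampling steps is at most $\sum_{A\in\mathcal A}\frac{x(A)}{1-x(A)}$. -/

import Mathlib

open MeasureTheory ProbabilityTheory
open scoped ENNReal

namespace LovaszLocal

section Events

variable {P : Type*} {E : P → Type*}

/-- The set of variables on which the event `A` depends. An event is given by the set of
evaluations `v : ∀ p, E p` of the variables that violate it, i.e. that make it happen; `vbl A` is
the intersection of all sets of variables that determine `A`. For finitely many variables it is the
least determining set, see `dependsOn_vbl` and `vbl_subset`. -/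
def vbl (A : Set (∀ p, E p)) : Set P :=
  ⋂₀ {S : Set P | DependsOn (fun v => v ∈ A) S}

theorem vbl_subset {A : Set (∀ p, E p)} {S : Set P} (h : DependsOn (fun v => v ∈ A) S) :
    vbl A ⊆ S :=
  Set.sInter_subset_of_mem h

theorem dependsOn_inter {A : Set (∀ p, E p)} {S T : Set P}
    (hS : DependsOn (fun v => v ∈ A) S) (hT : DependsOn (fun v => v ∈ A) T) :
    DependsOn (fun v => v ∈ A) (S ∩ T) := by
  classical
  intro f g h
  have h1 := @hS f (fun p => if p ∈ S then f p else g p) (fun p hp => by simp [hp])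
  have h2 := @hT (fun p => if p ∈ S then f p else g p) g (fun p hp => by
    by_cases hp' : p ∈ S
    · simpa [hp'] using h p ⟨hp', hp⟩
    · simp [hp'])
  exact h1.trans h2

/-- Finitely many variables: `vbl A` determines `A`, so it is the unique minimal such set. -/
theorem dependsOn_vbl [Finite P] (A : Set (∀ p, E p)) : DependsOn (fun v => v ∈ A) (vbl A) := by
  have key : ∀ 𝒮 : Set (Set P), 𝒮.Finite → (∀ S ∈ 𝒮, DependsOn (fun v => v ∈ A) S) →
      DependsOn (fun v => v ∈ A) (⋂₀ 𝒮) := by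
    intro 𝒮 h𝒮
    induction 𝒮, h𝒮 using Set.Finite.induction_on with
    | empty => intro _; rw [Set.sInter_empty]; exact dependsOn_univ _
    | insert _ _ ih =>
      intro h
      rw [Set.sInter_insert]
      exact dependsOn_inter (h _ (Set.mem_insert _ _))
        (ih fun S hS => h S (Set.mem_insert_of_mem _ hS))
  exact key _ (Set.toFinite _) fun _ hS => hS

/-- Two events are lopsidependent if there are evaluations `f` and `g` that differ only on
variables in `vbl A ∩ vbl B` such that `f` violates `A` and `g` violates `B`, but `f` does not
violate `B` or `g` does not violate `A`. -/
def Lopsidependent (A B : Set (∀ p, E p)) : Prop :=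
  ∃ f g : ∀ p, E p, (∀ p, p ∉ vbl A ∩ vbl B → f p = g p) ∧
    f ∈ A ∧ g ∈ B ∧ (f ∉ B ∨ g ∉ A)

/-- The lopsidependency graph of a family of events. -/
def lopsidependencyGraph {ι : Type*} (A : ι → Set (∀ p, E p)) : SimpleGraph ι where
  Adj a b := Lopsidependent (A a) (A b)
  symm := ⟨fun _ _ ⟨f, g, h, hf, hg, hfg⟩ =>
    ⟨g, f, fun p hp => (h p fun hp' => hp ⟨hp'.2, hp'.1⟩).symm, hg, hf, hfg.symm⟩⟩
  loopless := ⟨fun _ ⟨_, _, _, hf, hg, hfg⟩ => hfg.elim (fun h => h hf) (fun h => h hg)⟩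

open Classical in
/-- The neighbourhood of the event with index `a` in the lopsidependency graph. -/
noncomputable def lopsiNeighbors {ι : Type*} [Fintype ι] (A : ι → Set (∀ p, E p)) (a : ι) :
    Finset ι :=
  (lopsidependencyGraph A).neighborFinset a

end Events

section Algorithm

variable {P : Type*} {E : P → Type*} [∀ p, MeasurableSpace (E p)] {ι : Type*}

/-- A (deterministic or randomized) procedure by which the sequential algorithm decides which
violated event to resample next. After `n` resamplings it sees the evaluations `h 0, …, h n` the
algorithm has had so far, the last one being the current one, and its own random seed `s`. It
returns a violated event, or `none` if (and only if) no event is violated. -/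
structure SelectionRule (A : ι → Set (∀ p, E p)) (S : Type*) [MeasurableSpace S] where
  /-- the event selected from the seed and the history -/
  pick : S → (n : ℕ) → (Fin (n + 1) → ∀ p, E p) → Option ι
  violated_of_pick : ∀ s n h a, pick s n h = some a → h (Fin.last n) ∈ A a
  not_violated_of_pick : ∀ s n h, pick s n h = none → ∀ a, h (Fin.last n) ∉ A a
  measurableSet_pick : ∀ n a,
    MeasurableSet {q : S × (Fin (n + 1) → ∀ p, E p) | pick q.1 n q.2 = some a}

variable {A : ι → Set (∀ p, E p)} {S : Type*} [MeasurableSpace S]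

open Classical in
/-- Resampling: the variables in `vbl B` get the values in the fresh sample `r`, the other variables
keep their values in `v`. -/
noncomputable def resample (B : Set (∀ p, E p)) (v r : ∀ p, E p) : ∀ p, E p :=
  fun p => if p ∈ vbl B then r p else v p

/-- The evaluations during the first `n` resampling steps of the sequential algorithm, run with the
seed `s` for the selections and the sequence `r 0, r 1, …` of fresh samples: the algorithm starts
with `r 0`, and its resampling step number `n + 1` uses `r (n + 1)`. When no event is violated, the
algorithm has stopped and the evaluation remains what it is. -/
noncomputable def SelectionRule.history (σ : SelectionRule A S) (s : S) (r : ℕ → ∀ p, E p) :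
    (n : ℕ) → (Fin (n + 1) → ∀ p, E p)
  | 0 => fun _ => r 0
  | n + 1 =>
    let h := σ.history s r n
    Fin.snoc (α := fun _ => ∀ p, E p) h
      (match σ.pick s n h with
        | some a => resample (A a) (h (Fin.last n)) (r (n + 1))
        | none => h (Fin.last n))

/-- The evaluation after `n` resampling steps (the final one, if there are fewer steps). -/
noncomputable def SelectionRule.eval (σ : SelectionRule A S) (s : S) (r : ℕ → ∀ p, E p) (n : ℕ) :
    ∀ p, E p :=
  σ.history s r n (Fin.last n)

/-- The log of the execution: the event that is resampled after `n` previous resamplings; `none` if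
the algorithm has stopped. -/
noncomputable def SelectionRule.log (σ : SelectionRule A S) (s : S) (r : ℕ → ∀ p, E p) (n : ℕ) :
    Option ι :=
  σ.pick s n (σ.history s r n)

/-- The number of times that the event with index `a` is resampled. -/
noncomputable def SelectionRule.count (σ : SelectionRule A S) (a : ι) (s : S)
    (r : ℕ → ∀ p, E p) : ℝ≥0∞ :=
  ({n : ℕ | σ.log s r n = some a}.encard : ℝ≥0∞)

/-- The total number of resampling steps. -/
noncomputable def SelectionRule.totalCount (σ : SelectionRule A S) (s : S)
    (r : ℕ → ∀ p, E p) : ℝ≥0∞ :=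
  ({n : ℕ | σ.log s r n ≠ none}.encard : ℝ≥0∞)

variable [Fintype P] {Ω : Type*} [MeasurableSpace Ω]

/-- The law of the randomness of the algorithm: the seed of the selection procedure has law `ν`;
independently of it, the samples of all variables in all rounds are independent, each distributed as
the variable. -/
noncomputable def randomSource (ν : Measure S) (μ : Measure Ω) (X : ∀ p, Ω → E p) :
    Measure (S × (ℕ → ∀ p, E p)) :=
  ν.prod (Measure.infinitePi fun _ : ℕ => Measure.pi fun p => μ.map (X p))

theorem isProbabilityMeasure_randomSource (ν : Measure S) [IsProbabilityMeasure ν] (μ : Measure Ω)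
    [IsProbabilityMeasure μ] (X : ∀ p, Ω → E p) (hX : ∀ p, Measurable (X p)) :
    IsProbabilityMeasure (randomSource ν μ X) := by
  have : ∀ p, IsProbabilityMeasure (μ.map (X p)) := fun p =>
    Measure.isProbabilityMeasure_map (hX p).aemeasurable
  unfold randomSource
  infer_instance

end Algorithm

end LovaszLocal

/-! The operator of an event `A` sends `φ` to the function of `v` that is the mean of `φ` after
resampling `A` if `v` violates `A`, and `0` otherwise. Two facts carry the proof. Operators of
events that are not lopsidependent commute (`commute_violationOp`), and the operator of `A`
multiplies the integral over the product law by the probability of `A` (`lintegral_violationOp`).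

A resampling of `a` is explained by a list of independent layers of events: the first layer is
`{a}`, and each further layer lies in the closed neighbourhood of the one above it. Deeper layers
are earlier in time. Going back one step in time, to a resampling of `f`, puts `f` directly below
the last layer that it touches, or drops it if there is none. By commutation this agrees with
composing operators, up to an inequality when `f` is dropped. Since the insertion is injective, the
sum of the weights of all lists is a potential whose drop in each step pays for a resampling of `a`
(`potential_step`).

Initially the mean of the potential is a sum of products of probabilities. With `y = x / (1 - x)`,
so that `1 + y = 1 / (1 - x)`, the hypothesis bounds this sum by `y a` (`sum_chains_prod_le`). A
finite expected total forces termination almost surely. The law of each evaluation of the algorithm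
is absolutely continuous with respect to the product law, so the good evaluations cannot be a null
set. -/

namespace LovaszLocal

/-! ### Layered lists of events: insertion, enumeration, operator products -/

section Layerings

open scoped Classical

variable {ι : Type*} (G : SimpleGraph ι)

/-- The vertex `f` lies in the closed neighbourhood of the set `I`. -/
def Touches (f : ι) (I : Finset ι) : Prop :=
  ∃ b ∈ I, f = b ∨ G.Adj f b

/-- The vertex `f` lies in the closed neighbourhood of one of the layers in `L`. -/
def TouchesAny (f : ι) (L : List (Finset ι)) : Prop :=
  ∃ I ∈ L, Touches G f I

variable {G}

theorem touches_of_mem {f : ι} {I : Finset ι} (h : f ∈ I) : Touches G f I :=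
  ⟨f, h, Or.inl rfl⟩

theorem touches_insert_self (f : ι) (I : Finset ι) : Touches G f (insert f I) :=
  touches_of_mem (Finset.mem_insert_self f I)

theorem Touches.mono {f : ι} {I J : Finset ι} (h : Touches G f I) (hIJ : I ⊆ J) :
    Touches G f J :=
  let ⟨b, hb, hfb⟩ := h
  ⟨b, hIJ hb, hfb⟩

@[simp]
theorem not_touchesAny_nil (f : ι) : ¬ TouchesAny G f [] := by
  simp [TouchesAny]

@[simp]
theorem touchesAny_cons {f : ι} {I : Finset ι} {L : List (Finset ι)} :
    TouchesAny G f (I :: L) ↔ Touches G f I ∨ TouchesAny G f L := by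
  simp [TouchesAny]

/-- Add a vertex to the first layer. -/
noncomputable def addHead (f : ι) : List (Finset ι) → List (Finset ι)
  | [] => [{f}]
  | J :: L => insert f J :: L

variable (G) in
/-- Insert a vertex into a list of layers: it is put directly below the last layer that it touches;
a vertex that touches no layer is dropped. -/
noncomputable def insertLayer (f : ι) : List (Finset ι) → List (Finset ι)
  | [] => []
  | I :: L =>
    if TouchesAny G f L then I :: insertLayer f L
    else if Touches G f I then I :: addHead f L
    else I :: L

theorem insertLayer_cons_of_touchesAny {f : ι} {I : Finset ι} {L : List (Finset ι)}
    (h : TouchesAny G f L) : insertLayer G f (I :: L) = I :: insertLayer G f L := by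
  simp [insertLayer, h]

theorem insertLayer_cons_of_touches {f : ι} {I : Finset ι} {L : List (Finset ι)}
    (h : ¬ TouchesAny G f L) (h' : Touches G f I) :
    insertLayer G f (I :: L) = I :: addHead f L := by
  simp [insertLayer, h, h']

theorem insertLayer_of_not_touchesAny {f : ι} {L : List (Finset ι)} (h : ¬ TouchesAny G f L) :
    insertLayer G f L = L := by
  cases L with
  | nil => rfl
  | cons I L =>
    rw [touchesAny_cons, not_or] at h
    simp [insertLayer, h.1, h.2]

theorem touchesAny_addHead (f : ι) (L : List (Finset ι)) : TouchesAny G f (addHead f L) := by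
  cases L with
  | nil => simpa [addHead] using touches_of_mem (Finset.mem_singleton_self f)
  | cons J L => simp [addHead, touches_insert_self]

/-- The vertex goes strictly below a layer that it touches, so never into the first layer. This
separates the cases in `insertLayer_inj` and keeps the one-layer list out of the image in
`potential_step`. -/
theorem touchesAny_tail_insertLayer {f : ι} {L : List (Finset ι)} (h : TouchesAny G f L) :
    TouchesAny G f (insertLayer G f L).tail := by
  induction L with
  | nil => simp at h
  | cons I L ih =>
    by_cases hL : TouchesAny G f L
    · rw [insertLayer_cons_of_touchesAny hL]
      obtain ⟨J, hJ, hf⟩ := ih hL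
      exact ⟨J, List.mem_of_mem_tail hJ, hf⟩
    · rw [insertLayer_cons_of_touches hL ((touchesAny_cons.1 h).resolve_right hL)]
      exact touchesAny_addHead f L

theorem touchesAny_insertLayer {f : ι} {L : List (Finset ι)} (h : TouchesAny G f L) :
    TouchesAny G f (insertLayer G f L) :=
  let ⟨J, hJ, hf⟩ := touchesAny_tail_insertLayer h
  ⟨J, List.mem_of_mem_tail hJ, hf⟩

theorem not_touchesAny_tail_addHead {f : ι} {L : List (Finset ι)} (h : ¬ TouchesAny G f L) :
    ¬ TouchesAny G f (addHead f L).tail := by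
  cases L with
  | nil => simp [addHead]
  | cons J L =>
    rw [touchesAny_cons, not_or] at h
    simpa [addHead] using h.2

/-- Erasing `f` from the first layer undoes the addition; the only ambiguity, no layer versus an
empty one, is excluded by `hne` and `hne'`. -/
theorem addHead_inj {f : ι} {L L' : List (Finset ι)} (h : ¬ TouchesAny G f L)
    (h' : ¬ TouchesAny G f L') (hne : ∅ ∉ L) (hne' : ∅ ∉ L')
    (heq : addHead f L = addHead f L') : L = L' := by
  have key : ∀ (J : Finset ι) (M : List (Finset ι)), ¬ TouchesAny G f (J :: M) → ∅ ∉ J :: M →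
      addHead f [] ≠ addHead f (J :: M) := by
    intro J M h hne heq
    simp only [addHead, List.cons.injEq] at heq
    refine hne ?_
    have hJ : J = ∅ := Finset.eq_empty_of_forall_notMem fun b hb => by
      have : b = f := by
        have : b ∈ ({f} : Finset ι) := heq.1 ▸ Finset.mem_insert_of_mem hb
        simpa using this
      exact h (touchesAny_cons.2 (Or.inl (touches_of_mem (this ▸ hb))))
    simp [hJ]
  cases L with
  | nil =>
    cases L' with
    | nil => rfl
    | cons J' M' => exact absurd heq (key J' M' h' hne')
  | cons J M =>
    cases L' with
    | nil => exact absurd heq.symm (key J M h hne)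
    | cons J' M' =>
      simp only [addHead, List.cons.injEq] at heq
      rw [touchesAny_cons, not_or] at h h'
      have hf : f ∉ J := fun hf => h.1 (touches_of_mem hf)
      have hf' : f ∉ J' := fun hf => h'.1 (touches_of_mem hf)
      rw [heq.2, ← Finset.erase_insert hf, heq.1, Finset.erase_insert hf']

/-- The result shows where `f` went: its own layer is the last one that it touches, and if it
touches none then it was dropped. -/
theorem insertLayer_inj {f : ι} {L L' : List (Finset ι)} (hne : ∅ ∉ L) (hne' : ∅ ∉ L')
    (heq : insertLayer G f L = insertLayer G f L') : L = L' := by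
  induction L generalizing L' with
  | nil =>
    cases L' with
    | nil => rfl
    | cons I L' =>
      simp only [insertLayer] at heq
      split_ifs at heq
  | cons I L ih =>
    cases L' with
    | nil =>
      simp only [insertLayer] at heq
      split_ifs at heq
    | cons I' L' =>
      have hne1 : ∅ ∉ L := fun h => hne (List.mem_cons_of_mem _ h)
      have hne2 : ∅ ∉ L' := fun h => hne' (List.mem_cons_of_mem _ h)
      have hI : I = I' := by
        simp only [insertLayer] at heq
        split_ifs at heq <;> exact (List.cons.inj heq).1
      subst hI
      by_cases h : TouchesAny G f L <;> by_cases h' : TouchesAny G f L'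
      · rw [insertLayer_cons_of_touchesAny h, insertLayer_cons_of_touchesAny h'] at heq
        rw [ih hne1 hne2 (List.cons.inj heq).2]
      · exfalso
        rw [insertLayer_cons_of_touchesAny h] at heq
        by_cases hI : Touches G f I
        · rw [insertLayer_cons_of_touches h' hI] at heq
          refine not_touchesAny_tail_addHead h' ?_
          rw [← (List.cons.inj heq).2]
          exact touchesAny_tail_insertLayer h
        · rw [insertLayer_of_not_touchesAny (L := I :: L') (by simp [hI, h'])] at heq
          refine h' ?_
          rw [← (List.cons.inj heq).2]
          exact touchesAny_insertLayer h
      · exfalso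
        rw [insertLayer_cons_of_touchesAny h'] at heq
        by_cases hI : Touches G f I
        · rw [insertLayer_cons_of_touches h hI] at heq
          refine not_touchesAny_tail_addHead h ?_
          rw [(List.cons.inj heq).2]
          exact touchesAny_tail_insertLayer h'
        · rw [insertLayer_of_not_touchesAny (L := I :: L) (by simp [hI, h])] at heq
          refine h ?_
          rw [(List.cons.inj heq).2]
          exact touchesAny_insertLayer h'
      · by_cases hI : Touches G f I
        · rw [insertLayer_cons_of_touches h hI, insertLayer_cons_of_touches h' hI] at heq
          rw [addHead_inj h h' hne1 hne2 (List.cons.inj heq).2]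
        · rwa [insertLayer_of_not_touchesAny (L := I :: L) (by simp [hI, h]),
            insertLayer_of_not_touchesAny (L := I :: L') (by simp [hI, h'])] at heq

variable (G) in
/-- No two distinct vertices in `I` are adjacent. -/
def IsIndep (I : Finset ι) : Prop :=
  ∀ b ∈ I, ∀ c ∈ I, ¬ G.Adj b c

theorem isIndep_singleton (a : ι) : IsIndep G {a} := by
  simp [IsIndep]

theorem IsIndep.insert {f : ι} {I : Finset ι} (hI : IsIndep G I) (hf : ¬ Touches G f I) :
    IsIndep G (insert f I) := by
  have h : ∀ b ∈ I, ¬ G.Adj f b := fun b hb hfb => hf ⟨b, hb, Or.inr hfb⟩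
  intro b hb c hc
  rw [Finset.mem_insert] at hb hc
  rcases hb with rfl | hb <;> rcases hc with rfl | hc
  · exact G.irrefl
  · exact h c hc
  · exact fun hbc => h b hb hbc.symm
  · exact hI b hb c hc

section Chains

variable [Fintype ι]

variable (G) in
/-- The closed neighbourhood of a set of vertices. -/
noncomputable def closedNbhd (I : Finset ι) : Finset ι :=
  Finset.univ.filter fun f => Touches G f I

theorem mem_closedNbhd {f : ι} {I : Finset ι} : f ∈ closedNbhd G I ↔ Touches G f I := by
  simp [closedNbhd]

variable (G) in
/-- The possible layers below the layer `I`: nonempty independent subsets of its closed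
neighbourhood. -/
noncomputable def nextLayers (I : Finset ι) : Finset (Finset ι) :=
  (closedNbhd G I).powerset.filter fun J => J.Nonempty ∧ IsIndep G J

theorem mem_nextLayers {I J : Finset ι} :
    J ∈ nextLayers G I ↔ (∀ f ∈ J, Touches G f I) ∧ J.Nonempty ∧ IsIndep G J := by
  simp [nextLayers, mem_closedNbhd, Finset.subset_iff]

variable (G) in
/-- The lists of at most `k` layers with first layer `I`. -/
noncomputable def chains : ℕ → Finset ι → Finset (List (Finset ι))
  | 0, _ => ∅
  | k + 1, I => (insert [] ((nextLayers G I).biUnion (chains k))).image (List.cons I)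

@[simp]
theorem chains_zero (I : Finset ι) : chains G 0 I = ∅ := rfl

theorem mem_chains_succ {k : ℕ} {I : Finset ι} {L : List (Finset ι)} :
    L ∈ chains G (k + 1) I ↔
      L = [I] ∨ ∃ J ∈ nextLayers G I, ∃ M ∈ chains G k J, L = I :: M := by
  simp only [chains, Finset.image_insert, Finset.mem_insert, Finset.mem_image, Finset.mem_biUnion]
  constructor
  · rintro (h | ⟨M, ⟨J, hJ, hM⟩, rfl⟩)
    · exact Or.inl h
    · exact Or.inr ⟨J, hJ, M, hM, rfl⟩
  · rintro (h | ⟨J, hJ, M, hM, rfl⟩)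
    · exact Or.inl h
    · exact Or.inr ⟨M, ⟨J, hJ, hM⟩, rfl⟩

theorem exists_eq_cons_of_mem_chains {k : ℕ} {I : Finset ι} {L : List (Finset ι)}
    (h : L ∈ chains G k I) : ∃ M, L = I :: M := by
  cases k with
  | zero => simp at h
  | succ k =>
    rcases mem_chains_succ.1 h with rfl | ⟨_, _, M, _, rfl⟩
    exacts [⟨_, rfl⟩, ⟨_, rfl⟩]

theorem chains_subset_succ (k : ℕ) (I : Finset ι) : chains G k I ⊆ chains G (k + 1) I := by
  induction k generalizing I with
  | zero => simp
  | succ k ih =>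
    intro L hL
    rw [mem_chains_succ] at hL ⊢
    rcases hL with rfl | ⟨J, hJ, M, hM, rfl⟩
    · exact Or.inl rfl
    · exact Or.inr ⟨J, hJ, M, ih J hM, rfl⟩

theorem empty_notMem_of_mem_chains {k : ℕ} {I : Finset ι} {L : List (Finset ι)}
    (hI : I.Nonempty) (h : L ∈ chains G k I) : ∅ ∉ L := by
  induction k generalizing I L with
  | zero => simp at h
  | succ k ih =>
    rcases mem_chains_succ.1 h with rfl | ⟨J, hJ, M, hM, rfl⟩
    · simpa using hI.ne_empty.symm
    · have := ih (mem_nextLayers.1 hJ).2.1 hM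
      simpa [this] using hI.ne_empty.symm

theorem isIndep_of_mem_chains {k : ℕ} {I : Finset ι} {L : List (Finset ι)}
    (hI : IsIndep G I) (h : L ∈ chains G k I) : ∀ J ∈ L, IsIndep G J := by
  induction k generalizing I L with
  | zero => simp at h
  | succ k ih =>
    rcases mem_chains_succ.1 h with rfl | ⟨J, hJ, M, hM, rfl⟩
    · simpa using hI
    · simpa [hI] using ih (mem_nextLayers.1 hJ).2.2 hM

theorem addHead_mem_chains {k : ℕ} {f : ι} {J : Finset ι} {L : List (Finset ι)}
    (h : L ∈ chains G k J) : addHead f L ∈ chains G k (insert f J) := by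
  cases k with
  | zero => simp at h
  | succ k =>
    rw [mem_chains_succ] at h ⊢
    rcases h with rfl | ⟨J', hJ', M, hM, rfl⟩
    · exact Or.inl rfl
    · refine Or.inr ⟨J', ?_, M, hM, rfl⟩
      rw [mem_nextLayers] at hJ' ⊢
      exact ⟨fun b hb => (hJ'.1 b hb).mono (Finset.subset_insert f J), hJ'.2⟩

/-- The layer that receives `f` was not touched by it, so it stays independent, and enlarging it
keeps the layer below admissible. At most one layer is added, at the bottom. -/
theorem insertLayer_mem_chains {k : ℕ} {f : ι} {I : Finset ι} {L : List (Finset ι)}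
    (h : L ∈ chains G k I) : insertLayer G f L ∈ chains G (k + 1) I := by
  induction k generalizing I L with
  | zero => simp at h
  | succ k ih =>
    by_cases hf : TouchesAny G f L
    swap
    · rw [insertLayer_of_not_touchesAny hf]
      exact chains_subset_succ _ _ h
    rcases mem_chains_succ.1 h with rfl | ⟨J, hJ, M, hM, rfl⟩
    · have hI : Touches G f I := by simpa using hf
      rw [insertLayer_cons_of_touches (by simp) hI, mem_chains_succ]
      refine Or.inr ⟨{f}, ?_, [{f}], mem_chains_succ.2 (Or.inl rfl), rfl⟩
      rw [mem_nextLayers]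
      exact ⟨by simpa using hI, by simp, isIndep_singleton f⟩
    · rw [mem_chains_succ]
      by_cases hM' : TouchesAny G f M
      · rw [insertLayer_cons_of_touchesAny hM']
        exact Or.inr ⟨J, hJ, _, ih hM, rfl⟩
      · have hI : Touches G f I := (touchesAny_cons.1 hf).resolve_right hM'
        rw [insertLayer_cons_of_touches hM' hI]
        refine Or.inr ⟨insert f J, ?_, _, chains_subset_succ _ _ (addHead_mem_chains hM), rfl⟩
        rw [mem_nextLayers] at hJ ⊢
        refine ⟨?_, by simp, hJ.2.2.insert fun hfJ => hM' ?_⟩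
        · simpa [hI] using hJ.1
        · obtain ⟨M', rfl⟩ := exists_eq_cons_of_mem_chains hM
          exact touchesAny_cons.2 (Or.inl hfJ)

/-- The sum, over the lists of layers with a given root, of the products of the weights of all their
vertices. -/
theorem sum_chains_prod_le {p y : ι → ℝ≥0∞}
    (hp : ∀ i, p i * ∏ j ∈ closedNbhd G {i}, (1 + y j) ≤ y i) (k : ℕ) (I : Finset ι) :
    ∑ L ∈ chains G k I, (L.map fun J => ∏ i ∈ J, p i).prod ≤ ∏ i ∈ I, y i := by
  induction k generalizing I with
  | zero => simp
  | succ k ih =>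
    have hbi : ∀ (s : Finset (Finset ι)) (g : List (Finset ι) → ℝ≥0∞),
        ∑ L ∈ s.biUnion (chains G k), g L ≤ ∑ J ∈ s, ∑ L ∈ chains G k J, g L := by
      intro s g
      induction s using Finset.induction_on with
      | empty => simp
      | insert J s hJ ihs =>
        rw [Finset.biUnion_insert, Finset.sum_insert hJ]
        refine le_trans ?_ (add_le_add le_rfl ihs)
        rw [← Finset.sum_union_inter]
        exact le_self_add
    have hnbhd : ∏ j ∈ closedNbhd G I, (1 + y j) ≤
        ∏ i ∈ I, ∏ j ∈ closedNbhd G {i}, (1 + y j) := by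
      have hI : closedNbhd G I = I.biUnion fun i => closedNbhd G {i} := by
        ext f
        simp only [mem_closedNbhd, Finset.mem_biUnion]
        simp [Touches]
      rw [hI]
      clear hI
      induction I using Finset.induction_on with
      | empty => simp
      | insert i I hi ihI =>
        rw [Finset.biUnion_insert, Finset.prod_insert hi]
        refine le_trans ?_ (mul_le_mul' le_rfl ihI)
        -- Vertices shared by two neighbourhoods are counted twice on the right, with factors at
        -- least `1`.
        rw [← Finset.prod_union_inter]
        exact le_mul_of_one_le_right' (Finset.one_le_prod' fun _ _ => le_self_add)
    calc ∑ L ∈ chains G (k + 1) I, (L.map fun J => ∏ i ∈ J, p i).prod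
        = (∏ i ∈ I, p i) * ∑ L ∈ insert [] ((nextLayers G I).biUnion (chains G k)),
            (L.map fun J => ∏ i ∈ J, p i).prod := by
          rw [chains, Finset.sum_image fun _ _ _ _ h => (List.cons.inj h).2, Finset.mul_sum]
          simp
      _ ≤ (∏ i ∈ I, p i) * (1 + ∑ J ∈ nextLayers G I, ∏ i ∈ J, y i) := by
          gcongr
          have hnil : [] ∉ (nextLayers G I).biUnion (chains G k) := by
            intro h
            obtain ⟨J, _, hJ⟩ := Finset.mem_biUnion.1 h
            obtain ⟨M, hM⟩ := exists_eq_cons_of_mem_chains hJ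
            simp at hM
          rw [Finset.sum_insert hnil]
          refine add_le_add (by simp) ((hbi _ _).trans (Finset.sum_le_sum fun J _ => ih J))
      _ ≤ (∏ i ∈ I, p i) * ∏ j ∈ closedNbhd G I, (1 + y j) := by
          gcongr
          -- The product expands over all subsets of the closed neighbourhood; the empty subset
          -- accounts for the list that ends at `I`.
          rw [Finset.prod_one_add]
          have h0 : (∅ : Finset ι) ∉ nextLayers G I := by simp [mem_nextLayers]
          have := Finset.sum_insert (f := fun J => ∏ i ∈ J, y i) h0
          rw [Finset.prod_empty] at this
          rw [← this]
          refine Finset.sum_le_sum_of_subset fun J hJ => ?_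
          rcases Finset.mem_insert.1 hJ with rfl | hJ
          · simp
          · exact (Finset.mem_filter.1 hJ).1
      _ ≤ ∏ i ∈ I, (p i * ∏ j ∈ closedNbhd G {i}, (1 + y j)) := by
          rw [Finset.prod_mul_distrib]
          gcongr
      _ ≤ ∏ i ∈ I, y i := Finset.prod_le_prod' fun i _ => hp i

end Chains

section Operators

variable {M : Type*} [Monoid M] (K : ι → M)

/-- The product of the operators of the vertices in a layer. -/
noncomputable def layerOp (I : Finset ι) : M :=
  (I.toList.map K).prod

/-- The product of the operators of all layers, the first layer being the last factor. -/
noncomputable def layersOp : List (Finset ι) → M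
  | [] => 1
  | I :: L => layersOp L * layerOp K I

variable {K} (hK : ∀ f b, f ≠ b → ¬ G.Adj f b → Commute (K f) (K b))
include hK

theorem commute_layerOp {f : ι} {I : Finset ι} (hf : ¬ Touches G f I) :
    Commute (K f) (layerOp K I) := by
  refine Commute.list_prod_right _ _ fun x hx => ?_
  obtain ⟨b, hb, rfl⟩ := List.mem_map.1 hx
  rw [Finset.mem_toList] at hb
  exact hK f b (fun h => hf ⟨b, hb, Or.inl h⟩) fun h => hf ⟨b, hb, Or.inr h⟩

theorem commute_layersOp {f : ι} {L : List (Finset ι)} (hf : ¬ TouchesAny G f L) :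
    Commute (K f) (layersOp K L) := by
  induction L with
  | nil => exact Commute.one_right _
  | cons I L ih =>
    rw [touchesAny_cons, not_or] at hf
    exact (ih hf.2).mul_right (commute_layerOp hK hf.1)

theorem layerOp_insert {f : ι} {I : Finset ι} (hI : IsIndep G I) (hf : ¬ Touches G f I) :
    layerOp K (insert f I) = K f * layerOp K I := by
  have hfI : f ∉ I := fun h => hf (touches_of_mem h)
  rw [layerOp, layerOp, ← List.prod_cons, ← List.map_cons]
  refine ((Finset.toList_insert hfI).map K).prod_eq' ?_
  rw [List.pairwise_map]
  refine (Finset.nodup_toList _).imp_of_mem fun {b c} hb hc hbc => ?_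
  rw [Finset.mem_toList] at hb hc
  exact hK b c hbc (hI.insert hf b hb c hc)

/-- The operator of `f` commutes past all deeper layers and joins the first one. -/
theorem mul_layersOp_eq_addHead {f : ι} {L : List (Finset ι)} (hL : ∀ I ∈ L, IsIndep G I)
    (hf : ¬ TouchesAny G f L) : K f * layersOp K L = layersOp K (addHead f L) := by
  cases L with
  | nil => simp [addHead, layersOp, layerOp]
  | cons J L =>
    rw [touchesAny_cons, not_or] at hf
    rw [addHead, layersOp, layersOp, layerOp_insert hK (hL J (by simp)) hf.1, ← mul_assoc,
      ← mul_assoc, (commute_layersOp hK hf.2).eq]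

theorem mul_layersOp_eq_insertLayer {f : ι} {L : List (Finset ι)} (hL : ∀ I ∈ L, IsIndep G I)
    (hf : TouchesAny G f L) : K f * layersOp K L = layersOp K (insertLayer G f L) := by
  induction L with
  | nil => simp at hf
  | cons I L ih =>
    have hL' : ∀ I ∈ L, IsIndep G I := fun J hJ => hL J (List.mem_cons_of_mem _ hJ)
    by_cases h : TouchesAny G f L
    · rw [insertLayer_cons_of_touchesAny h, layersOp, layersOp, ← mul_assoc, ih hL' h]
    · rw [insertLayer_cons_of_touches h ((touchesAny_cons.1 hf).resolve_right h), layersOp,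
        layersOp, ← mul_assoc, mul_layersOp_eq_addHead hK hL' h]

end Operators

end Layerings

/-! ### Resampling and lopsidependency -/

section Resampling

open scoped Classical

variable {P : Type*} {E : P → Type*}

/-- The evaluation with the values of `r` on `T` and those of `v` elsewhere. -/
noncomputable def resampleOn (T : Set P) (v r : ∀ p, E p) : ∀ p, E p :=
  fun p => if p ∈ T then r p else v p

theorem resample_eq_resampleOn (B : Set (∀ p, E p)) (v r : ∀ p, E p) :
    resample B v r = resampleOn (vbl B) v r := by
  funext p
  simp [resample, resampleOn]

section Lopsidependent

variable [Finite P] {A B : Set (∀ p, E p)}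

theorem mem_iff_of_eqOn_vbl {v w : ∀ p, E p} (h : ∀ p ∈ vbl A, v p = w p) : v ∈ A ↔ w ∈ A :=
  iff_of_eq (dependsOn_vbl A h)

omit [Finite P] in
theorem Lopsidependent.symm (h : Lopsidependent A B) : Lopsidependent B A :=
  let ⟨f, g, hfg, hf, hg, hor⟩ := h
  ⟨g, f, fun p hp => (hfg p fun hp' => hp ⟨hp'.2, hp'.1⟩).symm, hg, hf, hor.symm⟩

/-- If `A` is violated, and `B` after resampling `A`, for two events that are not lopsidependent,
then they are also violated when they are resampled in the reverse order. -/
theorem mem_and_mem_of_not_lopsidependent (h : ¬ Lopsidependent A B) {v r w : ∀ p, E p}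
    (hA : v ∈ A) (hB : resampleOn (vbl A) v r ∈ B) (hw : ∀ p ∈ vbl A ∩ vbl B, w p = r p)
    (hw' : ∀ p ∈ vbl A, p ∉ vbl B → w p = v p) : v ∈ B ∧ w ∈ A := by
  have hg : resampleOn (vbl A ∩ vbl B) v r ∈ B := by
    refine (mem_iff_of_eqOn_vbl fun p hp => ?_).1 hB
    simp [resampleOn, hp]
  have hdiff : ∀ p, p ∉ vbl A ∩ vbl B → v p = resampleOn (vbl A ∩ vbl B) v r p := by
    intro p hp
    simp only [resampleOn, if_neg hp]
  by_contra hcon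
  refine h ⟨v, _, hdiff, hA, hg, ?_⟩
  by_cases hvB : v ∈ B
  · refine Or.inr fun hgA => hcon ⟨hvB, (mem_iff_of_eqOn_vbl fun p hp => ?_).1 hgA⟩
    by_cases hpB : p ∈ vbl B
    · rw [hw p ⟨hp, hpB⟩]
      simp [resampleOn, hp, hpB]
    · rw [hw' p hp hpB]
      simp [resampleOn, hpB]
  · exact Or.inl hvB

/-- In either order, the first resampling takes its values on the shared variables from `r`; these
are the only values that matter for the second event beyond those of `v`. -/
theorem mem_and_resampleOn_mem_iff (h : ¬ Lopsidependent A B) (v r s : ∀ p, E p) :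
    v ∈ A ∧ resampleOn (vbl A) v r ∈ B ↔
      v ∈ B ∧ resampleOn (vbl B) v (resampleOn (vbl A ∩ vbl B)ᶜ r s) ∈ A := by
  constructor
  · rintro ⟨hA, hB⟩
    refine mem_and_mem_of_not_lopsidependent h hA hB (fun p hp => ?_) fun p _ hp => ?_
    · simp [resampleOn, hp.1, hp.2]
    · simp [resampleOn, hp]
  · rintro ⟨hB, hA⟩
    refine mem_and_mem_of_not_lopsidependent (fun h' => h h'.symm) hB hA (fun p hp => ?_)
      fun p _ hp => ?_
    · simp [resampleOn, hp.1, hp.2]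
    · simp [resampleOn, hp]

-- Exchanging `r` and `s` outside `T ∩ U` compensates for the reversed order: a variable in both
-- sets still ends with the value from `s`, a variable in only one keeps its own sample.
omit [Finite P] in
theorem resampleOn_resampleOn_comm (T U : Set P) (v r s : ∀ p, E p) :
    resampleOn U (resampleOn T v r) s =
      resampleOn T (resampleOn U v (resampleOn (T ∩ U)ᶜ r s)) (resampleOn (T ∩ U)ᶜ s r) := by
  funext p
  by_cases hT : p ∈ T <;> by_cases hU : p ∈ U <;> simp [resampleOn, hT, hU]

end Lopsidependent

variable [∀ p, MeasurableSpace (E p)]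

theorem measurable_resampleOn (T : Set P) :
    Measurable fun q : (∀ p, E p) × (∀ p, E p) => resampleOn T q.1 q.2 := by
  refine measurable_pi_lambda _ fun p => ?_
  by_cases hp : p ∈ T
  · simp only [resampleOn, if_pos hp]
    exact (measurable_pi_apply p).comp measurable_snd
  · simp only [resampleOn, if_neg hp]
    exact (measurable_pi_apply p).comp measurable_fst

variable [Fintype P]

/-- Exchanging some coordinates of two independent samples preserves their joint law. -/
theorem measurePreserving_exchange (m : ∀ p, Measure (E p)) [∀ p, IsProbabilityMeasure (m p)]
    (T : Set P) :
    MeasurePreserving (fun q : (∀ p, E p) × (∀ p, E p) =>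
      (resampleOn T q.1 q.2, resampleOn T q.2 q.1))
      ((Measure.pi m).prod (Measure.pi m)) ((Measure.pi m).prod (Measure.pi m)) := by
  have hmeas : Measurable fun q : (∀ p, E p) × (∀ p, E p) =>
      (resampleOn T q.1 q.2, resampleOn T q.2 q.1) :=
    (measurable_resampleOn T).prodMk ((measurable_resampleOn T).comp measurable_swap)
  refine ⟨hmeas, (Measure.prod_eq_generateFrom generateFrom_pi generateFrom_pi isPiSystem_pi
    isPiSystem_pi (Measure.FiniteSpanningSetsIn.pi fun p => (m p).toFiniteSpanningSetsIn)
    (Measure.FiniteSpanningSetsIn.pi fun p => (m p).toFiniteSpanningSetsIn) ?_).symm⟩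
  rintro _ ⟨s, hs, rfl⟩ _ ⟨t, ht, rfl⟩
  have hs' : ∀ p, MeasurableSet (s p) := fun p => hs p (Set.mem_univ p)
  have ht' : ∀ p, MeasurableSet (t p) := fun p => ht p (Set.mem_univ p)
  rw [Measure.map_apply hmeas
    ((MeasurableSet.univ_pi hs').prod (MeasurableSet.univ_pi ht'))]
  -- It suffices to test on products of boxes, and the exchange merely permutes their factors.
  have hpre : (fun q : (∀ p, E p) × (∀ p, E p) =>
      (resampleOn T q.1 q.2, resampleOn T q.2 q.1)) ⁻¹' (Set.univ.pi s ×ˢ Set.univ.pi t) =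
      (Set.univ.pi fun p => if p ∈ T then t p else s p) ×ˢ
        (Set.univ.pi fun p => if p ∈ T then s p else t p) := by
    ext q
    simp only [Set.mem_preimage, Set.mem_prod, Set.mem_univ_pi, ← forall_and]
    refine forall_congr' fun p => ?_
    by_cases hp : p ∈ T <;> simp [resampleOn, hp, and_comm]
  rw [hpre, Measure.prod_prod, Measure.pi_pi, Measure.pi_pi, Measure.pi_pi, Measure.pi_pi,
    ← Finset.prod_mul_distrib, ← Finset.prod_mul_distrib]
  refine Finset.prod_congr rfl fun p _ => ?_
  by_cases hp : p ∈ T <;> simp [hp, mul_comm]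

end Resampling

/-! ### The operator of an event -/

section ViolationOperator

variable {P : Type*} {E : P → Type*} [∀ p, MeasurableSpace (E p)]

variable (E) in
/-- The nonnegative measurable functions of the evaluations. -/
abbrev MeasurableWeight := {φ : (∀ p, E p) → ℝ≥0∞ // Measurable φ}

variable {A B : Set (∀ p, E p)} (π : Measure (∀ p, E p)) [SFinite π]

/-- The operator that maps `φ` to the function whose value at an evaluation `v` that violates `A` is
the expectation of `φ` after resampling `A`; its value is `0` where `A` is not violated. -/
noncomputable def violationOp (hA : MeasurableSet A) : Function.End (MeasurableWeight E) :=
  fun φ => ⟨fun v => A.indicator 1 v * ∫⁻ r, φ.1 (resampleOn (vbl A) v r) ∂π,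
    (measurable_one.indicator hA).mul
      (φ.2.comp (measurable_resampleOn (vbl A))).lintegral_prod_right'⟩

theorem violationOp_apply (hA : MeasurableSet A) (φ : MeasurableWeight E) (v : ∀ p, E p) :
    (violationOp π hA φ).1 v = A.indicator 1 v * ∫⁻ r, φ.1 (resampleOn (vbl A) v r) ∂π :=
  rfl

theorem violationOp_mono (hA : MeasurableSet A) : Monotone (violationOp π hA) := by
  intro φ ψ h v
  exact mul_le_mul' le_rfl (lintegral_mono fun r => h _)

theorem violationOp_mul_apply (hA : MeasurableSet A) (hB : MeasurableSet B)
    (φ : MeasurableWeight E) (v : ∀ p, E p) :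
    ((violationOp π hA * violationOp π hB) φ).1 v =
      ∫⁻ q : (∀ p, E p) × (∀ p, E p), A.indicator 1 v * (B.indicator 1 (resampleOn (vbl A) v q.1) *
        φ.1 (resampleOn (vbl B) (resampleOn (vbl A) v q.1) q.2)) ∂(π.prod π) := by
  have h1 : Measurable fun q : (∀ p, E p) × (∀ p, E p) => resampleOn (vbl A) v q.1 :=
    (measurable_resampleOn (vbl A)).comp (measurable_const.prodMk measurable_fst)
  have h2 : Measurable fun q : (∀ p, E p) × (∀ p, E p) =>
      φ.1 (resampleOn (vbl B) (resampleOn (vbl A) v q.1) q.2) :=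
    φ.2.comp ((measurable_resampleOn (vbl B)).comp (h1.prodMk measurable_snd))
  have h3 : Measurable fun q : (∀ p, E p) × (∀ p, E p) =>
      (B.indicator 1 (resampleOn (vbl A) v q.1) : ℝ≥0∞) *
        φ.1 (resampleOn (vbl B) (resampleOn (vbl A) v q.1) q.2) :=
    ((measurable_one.indicator hB).comp h1).mul h2
  rw [lintegral_const_mul _ h3, lintegral_prod _ h3.aemeasurable]
  change A.indicator 1 v * ∫⁻ r, (violationOp π hB φ).1 (resampleOn (vbl A) v r) ∂π = _
  congr 1
  refine lintegral_congr fun r => ?_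
  rw [violationOp_apply]
  exact (lintegral_const_mul _ (h2.comp measurable_prodMk_left)).symm

variable [Fintype P] (m : ∀ p, Measure (E p)) [∀ p, IsProbabilityMeasure (m p)]

/-- The operators of two events that are not lopsidependent commute. -/
theorem commute_violationOp (hA : MeasurableSet A) (hB : MeasurableSet B)
    (h : ¬ Lopsidependent A B) :
    Commute (violationOp (Measure.pi m) hA) (violationOp (Measure.pi m) hB) := by
  classical
  refine funext fun φ => Subtype.ext <| funext fun v => ?_
  have h1 : Measurable fun q : (∀ p, E p) × (∀ p, E p) => resampleOn (vbl B) v q.1 :=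
    (measurable_resampleOn (vbl B)).comp (measurable_const.prodMk measurable_fst)
  have hF : Measurable fun q : (∀ p, E p) × (∀ p, E p) =>
      (B.indicator 1 v : ℝ≥0∞) * (A.indicator 1 (resampleOn (vbl B) v q.1) *
        φ.1 (resampleOn (vbl A) (resampleOn (vbl B) v q.1) q.2)) :=
    (((measurable_one.indicator hA).comp h1).mul (φ.2.comp ((measurable_resampleOn
      (vbl A)).comp (h1.prodMk measurable_snd)))).const_mul _
  -- Exchanging the two samples outside the shared variables makes both orders end in the same
  -- evaluation.
  rw [violationOp_mul_apply, violationOp_mul_apply,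
    ← (measurePreserving_exchange m (vbl A ∩ vbl B)ᶜ).lintegral_comp hF]
  refine lintegral_congr fun q => ?_
  dsimp only
  rw [resampleOn_resampleOn_comm (vbl A) (vbl B) v q.1 q.2, ← mul_assoc, ← mul_assoc]
  congr 1
  have hmul : ∀ (C D : Set (∀ p, E p)) (u w : ∀ p, E p),
      (C.indicator 1 u * D.indicator 1 w : ℝ≥0∞) = if u ∈ C ∧ w ∈ D then 1 else 0 := by
    intro C D u w
    by_cases hu : u ∈ C <;> by_cases hw : w ∈ D <;> simp [hu, hw]
  rw [hmul, hmul, if_congr (mem_and_resampleOn_mem_iff h v q.1 q.2) rfl rfl]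

/-- Resampling a violated event restores the distribution of the variables. -/
theorem lintegral_violationOp (hA : MeasurableSet A) (φ : MeasurableWeight E) :
    ∫⁻ v, (violationOp (Measure.pi m) hA φ).1 v ∂(Measure.pi m) =
      Measure.pi m A * ∫⁻ v, φ.1 v ∂(Measure.pi m) := by
  have hF : Measurable fun q : (∀ p, E p) × (∀ p, E p) => A.indicator 1 q.2 * φ.1 q.1 :=
    ((measurable_one.indicator hA).comp measurable_snd).mul (φ.2.comp measurable_fst)
  -- After the exchange, the resampled evaluation is one coordinate, and whether `A` was violated
  -- depends only on the other, independent one.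
  have hex := (measurePreserving_exchange m (vbl A)).lintegral_comp hF
  have h2 : ∀ q : (∀ p, E p) × (∀ p, E p),
      A.indicator (1 : (∀ p, E p) → ℝ≥0∞) (resampleOn (vbl A) q.2 q.1) = A.indicator 1 q.1 := by
    intro q
    have : resampleOn (vbl A) q.2 q.1 ∈ A ↔ q.1 ∈ A :=
      mem_iff_of_eqOn_vbl fun p hp => by simp [resampleOn, hp]
    by_cases h : q.1 ∈ A <;> simp [this, h]
  simp only [h2] at hex
  have hG : Measurable fun q : (∀ p, E p) × (∀ p, E p) =>
      A.indicator (1 : (∀ p, E p) → ℝ≥0∞) q.1 * φ.1 (resampleOn (vbl A) q.1 q.2) :=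
    ((measurable_one.indicator hA).comp measurable_fst).mul
      (φ.2.comp (measurable_resampleOn (vbl A)))
  rw [lintegral_prod _ hG.aemeasurable, lintegral_prod_symm _ hF.aemeasurable] at hex
  have hG' : ∀ v, ∫⁻ r, A.indicator (1 : (∀ p, E p) → ℝ≥0∞) v *
      φ.1 (resampleOn (vbl A) v r) ∂(Measure.pi m) =
      (violationOp (Measure.pi m) hA φ).1 v := fun v => by
    rw [violationOp_apply, lintegral_const_mul]
    exact φ.2.comp ((measurable_resampleOn (vbl A)).comp measurable_prodMk_left)
  simp only [hG', lintegral_const_mul _ φ.2] at hex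
  rw [hex, lintegral_mul_const _ (measurable_one.indicator hA), lintegral_indicator_one hA]

end ViolationOperator

/-! ### The potential: total weight of the lists rooted at an event -/

section Potential

variable {P : Type*} [Fintype P] {E : P → Type*} [∀ p, MeasurableSpace (E p)]
  {ι : Type*} {A : ι → Set (∀ p, E p)}
  (m : ∀ p, Measure (E p)) [∀ p, IsProbabilityMeasure (m p)] (hA : ∀ a, MeasurableSet (A a))

/-- The operator of a list of layers of events. -/
noncomputable def layersEnd (L : List (Finset ι)) : Function.End (MeasurableWeight E) :=
  layersOp (fun a => violationOp (Measure.pi m) (hA a)) L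

/-- The weight function of a list of layers: an upper bound for the probability, as a function of
the initial evaluation, that the list occurs as the witness for a resampling. -/
noncomputable def layersWeight (L : List (Finset ι)) : MeasurableWeight E :=
  layersEnd m hA L ⟨1, measurable_one⟩

theorem commute_of_not_adj {f b : ι} (h : ¬ (lopsidependencyGraph A).Adj f b) :
    Commute (violationOp (Measure.pi m) (hA f)) (violationOp (Measure.pi m) (hA b)) :=
  commute_violationOp m (hA f) (hA b) h

theorem monotone_layersEnd (L : List (Finset ι)) : Monotone (layersEnd m hA L) := by
  have hlist : ∀ l : List ι, Monotone (α := MeasurableWeight E) (β := MeasurableWeight E)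
      (l.map fun a => violationOp (Measure.pi m) (hA a)).prod := by
    intro l
    induction l with
    | nil => exact monotone_id
    | cons a l ih =>
      rw [List.map_cons, List.prod_cons]
      exact (violationOp_mono _ (hA a)).comp ih
  induction L with
  | nil => exact monotone_id
  | cons I L ih => exact ih.comp (hlist _)

theorem violationOp_layersWeight_le (f : ι) {L : List (Finset ι)}
    (hL : ∀ I ∈ L, IsIndep (lopsidependencyGraph A) I) :
    violationOp (Measure.pi m) (hA f) (layersWeight m hA L) ≤
      layersWeight m hA (insertLayer (lopsidependencyGraph A) f L) := by
  have hK : ∀ f b, f ≠ b → ¬ (lopsidependencyGraph A).Adj f b →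
      Commute (violationOp (Measure.pi m) (hA f)) (violationOp (Measure.pi m) (hA b)) :=
    fun f b _ h => commute_of_not_adj m hA h
  by_cases hf : TouchesAny (lopsidependencyGraph A) f L
  · exact (congrFun (mul_layersOp_eq_insertLayer hK hL hf) _).le
  · rw [insertLayer_of_not_touchesAny hf]
    -- A dropped event commutes with everything, so its operator can act first on the constant `1`,
    -- where its value is at most `1`.
    refine (congrFun (commute_layersOp hK hf).eq _).le.trans ?_
    refine monotone_layersEnd m hA L fun v => ?_
    rw [violationOp_apply]
    by_cases hv : v ∈ A f <;> simp [hv]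

theorem lintegral_layersWeight (L : List (Finset ι)) :
    ∫⁻ v, (layersWeight m hA L).1 v ∂(Measure.pi m) =
      (L.map fun J => ∏ i ∈ J, Measure.pi m (A i)).prod := by
  have hlist : ∀ (l : List ι) (φ : MeasurableWeight E),
      ∫⁻ v, ((l.map fun a => violationOp (Measure.pi m) (hA a)).prod φ).1 v ∂(Measure.pi m) =
        (l.map fun a => Measure.pi m (A a)).prod * ∫⁻ v, φ.1 v ∂(Measure.pi m) := by
    intro l φ
    induction l with
    | nil => simp [Function.End.one_def]
    | cons a l ih =>
      simp only [List.map_cons, List.prod_cons]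
      rw [mul_assoc, ← ih]
      exact lintegral_violationOp m (hA a) _
  have key : ∀ φ : MeasurableWeight E,
      ∫⁻ v, (layersEnd m hA L φ).1 v ∂(Measure.pi m) =
        (L.map fun J => ∏ i ∈ J, Measure.pi m (A i)).prod * ∫⁻ v, φ.1 v ∂(Measure.pi m) := by
    induction L with
    | nil => simp [layersEnd, layersOp, Function.End.one_def]
    | cons I L ih =>
      intro φ
      rw [List.map_cons, List.prod_cons, ← Finset.prod_map_toList, mul_comm (List.prod _),
        mul_assoc, ← hlist]
      exact ih _
  rw [layersWeight, key]
  simp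

variable [Fintype ι]

/-- An upper bound for the expected number of resamplings of the event `a` in the next `k` steps, as
a function of the current evaluation. -/
noncomputable def potential (a : ι) (k : ℕ) (v : ∀ p, E p) : ℝ≥0∞ :=
  ∑ L ∈ chains (lopsidependencyGraph A) k {a}, (layersWeight m hA L).1 v

theorem measurable_potential (a : ι) (k : ℕ) : Measurable (potential m hA a k) :=
  Finset.measurable_sum _ fun L _ => (layersWeight m hA L).2

theorem potential_le_succ (a : ι) (k : ℕ) (v : ∀ p, E p) :
    potential m hA a k v ≤ potential m hA a (k + 1) v :=
  Finset.sum_le_sum_of_subset (chains_subset_succ k {a})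

-- Averaging over the resampling of `f` turns each list into its insertion of `f`. These are
-- distinct lists with one more layer allowed, and the list `[{a}]`, of weight `1` here, is left
-- over to pay for the resampling when `f = a`.
open scoped Classical in
theorem potential_step (a f : ι) (k : ℕ) {v : ∀ p, E p} (hv : v ∈ A f) :
    (if f = a then 1 else 0) + ∫⁻ r, potential m hA a k (resample (A f) v r) ∂(Measure.pi m) ≤
      potential m hA a (k + 1) v := by
  have hne : ∀ L ∈ chains (lopsidependencyGraph A) k {a}, ∅ ∉ L := fun L hL =>
    empty_notMem_of_mem_chains (Finset.singleton_nonempty a) hL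
  have hint : ∫⁻ r, potential m hA a k (resample (A f) v r) ∂(Measure.pi m) ≤
      ∑ L ∈ (chains (lopsidependencyGraph A) k {a}).image
        (insertLayer (lopsidependencyGraph A) f), (layersWeight m hA L).1 v := by
    rw [Finset.sum_image fun L hL L' hL' h => insertLayer_inj (hne L hL) (hne L' hL') h]
    simp only [potential, resample_eq_resampleOn]
    have hmeas : ∀ L : List (Finset ι), Measurable fun r =>
        (layersWeight m hA L).1 (resampleOn (vbl (A f)) v r) := fun L =>
      (layersWeight m hA L).2.comp ((measurable_resampleOn _).comp measurable_prodMk_left)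
    rw [lintegral_finsetSum _ fun L _ => hmeas L]
    refine Finset.sum_le_sum fun L hL => ?_
    refine le_trans ?_ (violationOp_layersWeight_le m hA f
      (isIndep_of_mem_chains (isIndep_singleton a) hL) v)
    rw [violationOp_apply]
    simp [hv]
  have himage : (chains (lopsidependencyGraph A) k {a}).image
      (insertLayer (lopsidependencyGraph A) f) ⊆ chains (lopsidependencyGraph A) (k + 1) {a} :=
    Finset.image_subset_iff.2 fun L hL => insertLayer_mem_chains hL
  split_ifs with hfa
  · subst hfa
    -- An insertion of `f` into a list rooted at `{f}` always has a second layer.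
    have hroot : [{f}] ∉ (chains (lopsidependencyGraph A) k {f}).image
        (insertLayer (lopsidependencyGraph A) f) := by
      intro h
      obtain ⟨L, hL, heq⟩ := Finset.mem_image.1 h
      obtain ⟨M, rfl⟩ := exists_eq_cons_of_mem_chains hL
      have := touchesAny_tail_insertLayer (G := lopsidependencyGraph A) (f := f) (L := {f} :: M)
        (touchesAny_cons.2 (Or.inl (touches_of_mem (Finset.mem_singleton_self f))))
      rw [heq] at this
      simp at this
    have hone : (layersWeight m hA [{f}]).1 v = 1 := by
      have : layersWeight m hA [{f}] =
          violationOp (Measure.pi m) (hA f) ⟨1, measurable_one⟩ := by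
        simp [layersWeight, layersEnd, layersOp, layerOp]
      rw [this, violationOp_apply]
      simp [hv]
    refine (add_le_add hone.ge hint).trans ?_
    rw [← Finset.sum_insert (f := fun L => (layersWeight m hA L).1 v) hroot]
    refine Finset.sum_le_sum_of_subset (Finset.insert_subset ?_ himage)
    exact mem_chains_succ.2 (Or.inl rfl)
  · rw [zero_add]
    exact hint.trans (Finset.sum_le_sum_of_subset himage)

theorem lintegral_potential_le {y : ι → ℝ≥0∞}
    (hy : ∀ i, Measure.pi m (A i) *
      ∏ j ∈ closedNbhd (lopsidependencyGraph A) {i}, (1 + y j) ≤ y i) (a : ι) (k : ℕ) :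
    ∫⁻ v, potential m hA a k v ∂(Measure.pi m) ≤ y a := by
  simp only [potential]
  rw [lintegral_finsetSum _ fun L _ => (layersWeight m hA L).2]
  simp only [lintegral_layersWeight]
  simpa using sum_chains_prod_le hy k {a}

end Potential

/-! ### Runs of the algorithm: dependence on the samples and measurability -/

section Execution

variable {P : Type*} {E : P → Type*} [∀ p, MeasurableSpace (E p)] {ι : Type*}
  {A : ι → Set (∀ p, E p)} {S : Type*} [MeasurableSpace S] (σ : SelectionRule A S)

/-- Later samples are independent of the history, so sample `n + 1` can be integrated out first. -/
theorem SelectionRule.history_update (s : S) (r : ℕ → ∀ p, E p) {n N : ℕ} (h : n < N)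
    (u : ∀ p, E p) : σ.history s (Function.update r N u) n = σ.history s r n := by
  induction n with
  | zero =>
    funext i
    simp [SelectionRule.history, Function.update_of_ne h.ne]
  | succ n ih => simp only [SelectionRule.history, ih (by omega), Function.update_of_ne h.ne]

theorem SelectionRule.eval_succ (s : S) (r : ℕ → ∀ p, E p) (n : ℕ) :
    σ.eval s r (n + 1) = (σ.log s r n).elim (σ.eval s r n)
      fun a => resample (A a) (σ.eval s r n) (r (n + 1)) := by
  simp only [SelectionRule.eval, SelectionRule.history, SelectionRule.log, Fin.snoc_last]
  cases σ.pick s n (σ.history s r n) <;> rfl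

theorem SelectionRule.eval_succ_update (s : S) (r : ℕ → ∀ p, E p) (n : ℕ) (u : ∀ p, E p) :
    σ.eval s (Function.update r (n + 1) u) (n + 1) = (σ.log s r n).elim (σ.eval s r n)
      fun a => resample (A a) (σ.eval s r n) u := by
  rw [SelectionRule.eval_succ]
  simp only [SelectionRule.eval, SelectionRule.log, σ.history_update s r (Nat.lt_succ_self n),
    Function.update_self]

theorem SelectionRule.eval_mem_of_log_eq_some {s : S} {r : ℕ → ∀ p, E p} {n : ℕ} {a : ι}
    (h : σ.log s r n = some a) : σ.eval s r n ∈ A a :=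
  σ.violated_of_pick s n _ a h

theorem SelectionRule.eval_notMem_of_log_eq_none {s : S} {r : ℕ → ∀ p, E p} {n : ℕ}
    (h : σ.log s r n = none) (a : ι) : σ.eval s r n ∉ A a :=
  σ.not_violated_of_pick s n _ h a

theorem SelectionRule.measurable_pick [Finite ι] (n : ℕ) :
    Measurable[_, ⊤] fun q : S × (Fin (n + 1) → ∀ p, E p) => σ.pick q.1 n q.2 := by
  let _ : MeasurableSpace (Option ι) := ⊤
  have hsome : ∀ a, MeasurableSet ((fun q : S × (Fin (n + 1) → ∀ p, E p) => σ.pick q.1 n q.2) ⁻¹'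
      {some a}) := fun a => σ.measurableSet_pick n a
  refine measurable_to_countable' fun o => ?_
  cases o with
  | some a => exact hsome a
  | none =>
    have : (fun q : S × (Fin (n + 1) → ∀ p, E p) => σ.pick q.1 n q.2) ⁻¹' {none} =
        (⋃ a, (fun q : S × (Fin (n + 1) → ∀ p, E p) => σ.pick q.1 n q.2) ⁻¹' {some a})ᶜ := by
      ext q
      simp [Option.eq_none_iff_forall_ne_some]
    rw [this]
    exact (MeasurableSet.iUnion hsome).compl

theorem measurable_optionElim [Finite ι] {α β : Type*} [MeasurableSpace α] [MeasurableSpace β]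
    {o : α → Option ι} (ho : Measurable[_, ⊤] o) {f : α → β} (hf : Measurable f)
    {g : ι → α → β} (hg : ∀ a, Measurable (g a)) :
    Measurable fun q => (o q).elim (f q) fun a => g a q := by
  let _ : MeasurableSpace (Option ι) := ⊤
  have : Measurable fun t : Option ι × α => t.1.elim (f t.2) fun a => g a t.2 := by
    refine measurable_from_prod_countable_right fun t => ?_
    cases t with
    | none => exact hf
    | some a => exact hg a
  exact this.comp (ho.prodMk measurable_id)

theorem measurable_resample_comp {α : Type*} [MeasurableSpace α] (B : Set (∀ p, E p))
    {v r : α → ∀ p, E p} (hv : Measurable v) (hr : Measurable r) :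
    Measurable fun q => resample B (v q) (r q) := by
  simp only [resample_eq_resampleOn]
  exact (measurable_resampleOn (vbl B)).comp (hv.prodMk hr)

variable [Finite ι]

theorem SelectionRule.measurable_history (n : ℕ) :
    Measurable fun q : S × (ℕ → ∀ p, E p) => σ.history q.1 q.2 n := by
  induction n with
  | zero => exact measurable_pi_lambda _ fun _ => (measurable_pi_apply 0).comp measurable_snd
  | succ n ih =>
    refine measurable_pi_lambda _ fun i => ?_
    refine Fin.lastCases ?_ (fun i => ?_) i
    · change Measurable fun q : S × (ℕ → ∀ p, E p) => σ.eval q.1 q.2 (n + 1)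
      simp only [SelectionRule.eval_succ]
      have heval : Measurable fun q : S × (ℕ → ∀ p, E p) => σ.eval q.1 q.2 n :=
        (measurable_pi_apply (Fin.last n)).comp ih
      refine measurable_optionElim ?_ heval fun a => measurable_resample_comp _ heval
        ((measurable_pi_apply (n + 1)).comp measurable_snd)
      exact (σ.measurable_pick n).comp (measurable_fst.prodMk ih)
    · simp only [SelectionRule.history, Fin.snoc_castSucc]
      exact (measurable_pi_apply i).comp ih

theorem SelectionRule.measurable_eval (n : ℕ) :
    Measurable fun q : S × (ℕ → ∀ p, E p) => σ.eval q.1 q.2 n :=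
  (measurable_pi_apply (Fin.last n)).comp (σ.measurable_history n)

theorem SelectionRule.measurable_log (n : ℕ) :
    Measurable[_, ⊤] fun q : S × (ℕ → ∀ p, E p) => σ.log q.1 q.2 n :=
  (σ.measurable_pick n).comp (measurable_fst.prodMk (σ.measurable_history n))

theorem SelectionRule.measurableSet_log_eq (n : ℕ) (o : Option ι) :
    MeasurableSet {q : S × (ℕ → ∀ p, E p) | σ.log q.1 q.2 n = o} :=
  σ.measurable_log n (MeasurableSpace.measurableSet_top (s := {o}))

end Execution

/-- Replacing one of countably many independent samples by a fresh one preserves their joint law. -/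
theorem measurePreserving_update {V : Type*} [MeasurableSpace V] (π : Measure V)
    [IsProbabilityMeasure π] (N : ℕ) :
    MeasurePreserving (fun q : (ℕ → V) × V => Function.update q.1 N q.2)
      ((Measure.infinitePi fun _ : ℕ => π).prod π) (Measure.infinitePi fun _ : ℕ => π) := by
  have hmeas : Measurable fun q : (ℕ → V) × V => Function.update q.1 N q.2 := by
    refine measurable_pi_lambda _ fun i => ?_
    by_cases hi : i = N
    · subst hi
      simpa using measurable_snd
    · simp only [Function.update_of_ne hi]
      exact (measurable_pi_apply i).comp measurable_fst
  refine ⟨hmeas, Measure.eq_infinitePi _ fun s t ht => ?_⟩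
  rw [Measure.map_apply hmeas (MeasurableSet.pi s.countable_toSet fun i _ => ht i)]
  by_cases hN : N ∈ s
  · have hpre : (fun q : (ℕ → V) × V => Function.update q.1 N q.2) ⁻¹' ((s : Set ℕ).pi t) =
        (((s.erase N : Finset ℕ) : Set ℕ).pi t) ×ˢ t N := by
      ext q
      simp only [Set.mem_preimage, Set.mem_pi, Set.mem_prod, Finset.mem_coe, Finset.mem_erase]
      constructor
      · intro h
        exact ⟨fun i hi => by simpa [Function.update_of_ne hi.1] using h i hi.2,
          by simpa using h N hN⟩
      · rintro ⟨h1, h2⟩ i hi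
        by_cases hiN : i = N
        · subst hiN
          simpa using h2
        · simpa [Function.update_of_ne hiN] using h1 i ⟨hiN, hi⟩
    rw [hpre, Measure.prod_prod, Measure.infinitePi_pi _ fun i _ => ht i, mul_comm,
      Finset.mul_prod_erase s (fun i => π (t i)) hN]
  · have hpre : (fun q : (ℕ → V) × V => Function.update q.1 N q.2) ⁻¹' ((s : Set ℕ).pi t) =
        ((s : Set ℕ).pi t) ×ˢ Set.univ := by
      ext q
      simp only [Set.mem_preimage, Set.mem_pi, Set.mem_prod, Finset.mem_coe, Set.mem_univ, and_true]
      refine forall₂_congr fun i hi => ?_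
      rw [Function.update_of_ne (ne_of_mem_of_not_mem hi hN)]
    rw [hpre, Measure.prod_prod, Measure.infinitePi_pi _ fun i _ => ht i, measure_univ, mul_one]

/-! ### Expected numbers of resamplings, termination and existence -/

section Expectation

variable {P : Type*} [Fintype P] {E : P → Type*} [∀ p, MeasurableSpace (E p)]
  {ι : Type*} [Fintype ι] {A : ι → Set (∀ p, E p)}
  (m : ∀ p, Measure (E p)) [∀ p, IsProbabilityMeasure (m p)] (hA : ∀ a, MeasurableSet (A a))
  {S : Type*} [MeasurableSpace S] (σ : SelectionRule A S) (ν : Measure S) [IsProbabilityMeasure ν]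

/-- The joint law of a seed and of independent samples of all variables in all rounds. -/
noncomputable abbrev sampleLaw : Measure (S × (ℕ → ∀ p, E p)) :=
  ν.prod (Measure.infinitePi fun _ : ℕ => Measure.pi m)

omit [Fintype ι] in
theorem lintegral_eval_zero {g : (∀ p, E p) → ℝ≥0∞} (hg : Measurable g) :
    ∫⁻ q, g (σ.eval q.1 q.2 0) ∂(sampleLaw m ν) = ∫⁻ v, g v ∂(Measure.pi m) := by
  have hmp : MeasurePreserving (fun q : S × (ℕ → ∀ p, E p) => q.2 0) (sampleLaw m ν)
      (Measure.pi m) :=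
    (measurePreserving_eval_infinitePi (fun _ : ℕ => Measure.pi m) 0).comp measurePreserving_snd
  exact hmp.lintegral_comp hg

omit [IsProbabilityMeasure ν] in
theorem lintegral_eval_succ {g : (∀ p, E p) → ℝ≥0∞} (hg : Measurable g) (n : ℕ) :
    ∫⁻ q, g (σ.eval q.1 q.2 (n + 1)) ∂(sampleLaw m ν) =
      ∫⁻ q, (σ.log q.1 q.2 n).elim (g (σ.eval q.1 q.2 n))
        (fun a => ∫⁻ u, g (resample (A a) (σ.eval q.1 q.2 n) u) ∂(Measure.pi m))
        ∂(sampleLaw m ν) := by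
  have hG : Measurable fun q : S × (ℕ → ∀ p, E p) => g (σ.eval q.1 q.2 (n + 1)) :=
    hg.comp (σ.measurable_eval (n + 1))
  have hH : Measurable fun q : S × (ℕ → ∀ p, E p) =>
      (σ.log q.1 q.2 n).elim (g (σ.eval q.1 q.2 n))
        (fun a => ∫⁻ u, g (resample (A a) (σ.eval q.1 q.2 n) u) ∂(Measure.pi m)) := by
    refine measurable_optionElim (σ.measurable_log n) (hg.comp (σ.measurable_eval n)) fun a => ?_
    have : Measurable fun t : (S × (ℕ → ∀ p, E p)) × (∀ p, E p) =>
        g (resample (A a) (σ.eval t.1.1 t.1.2 n) t.2) :=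
      hg.comp (measurable_resample_comp _ ((σ.measurable_eval n).comp measurable_fst)
        measurable_snd)
    exact this.lintegral_prod_right'
  rw [lintegral_prod _ hG.aemeasurable, lintegral_prod _ hH.aemeasurable]
  refine lintegral_congr fun s => ?_
  have hGs : Measurable fun r : ℕ → ∀ p, E p => g (σ.eval s r (n + 1)) :=
    hG.comp measurable_prodMk_left
  -- Sample `n + 1` is replaced by a fresh one, which leaves the log and the evaluation at time `n`
  -- unchanged.
  have hmp := measurePreserving_update (Measure.pi m) (n + 1)
  rw [← hmp.lintegral_comp hGs, lintegral_prod _ (by exact (hGs.comp hmp.measurable).aemeasurable)]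
  refine lintegral_congr fun r => ?_
  simp only [SelectionRule.eval_succ_update]
  cases σ.log s r n <;> simp

/-- Each step trades one unit of the depth bound against one unit of time, which is why `k` varies
in the induction. -/
theorem sum_measure_log_eq_add_le (a : ι) (n k : ℕ) :
    ∑ j ∈ Finset.range n, sampleLaw m ν {q | σ.log q.1 q.2 j = some a} +
      ∫⁻ q, potential m hA a k (σ.eval q.1 q.2 n) ∂(sampleLaw m ν) ≤
        ∫⁻ v, potential m hA a (k + n) v ∂(Measure.pi m) := by
  classical
  induction n generalizing k with
  | zero =>
    simpa using (lintegral_eval_zero m σ ν (measurable_potential m hA a k)).le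
  | succ n ih =>
    have hstep : sampleLaw m ν {q | σ.log q.1 q.2 n = some a} +
        ∫⁻ q, potential m hA a k (σ.eval q.1 q.2 (n + 1)) ∂(sampleLaw m ν) ≤
          ∫⁻ q, potential m hA a (k + 1) (σ.eval q.1 q.2 n) ∂(sampleLaw m ν) := by
      have hlog := σ.measurableSet_log_eq n (some a)
      rw [lintegral_eval_succ m σ ν (measurable_potential m hA a k), ← lintegral_indicator_one hlog,
        ← lintegral_add_left (measurable_one.indicator hlog)]
      refine lintegral_mono fun q => ?_
      cases h : σ.log q.1 q.2 n with
      -- After stopping, the evaluation is frozen and only the depth bound decreases.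
      | none => simpa [h] using potential_le_succ m hA a k _
      | some f =>
        simpa [h, Set.indicator_apply] using
          potential_step m hA a f k (σ.eval_mem_of_log_eq_some h)
    rw [Finset.sum_range_succ, add_assoc]
    refine (add_le_add le_rfl hstep).trans ((ih (k + 1)).trans_eq ?_)
    rw [add_right_comm, add_assoc]

omit [Fintype P] [Fintype ι] in
theorem encard_eq_tsum_indicator (s : Set ℕ) :
    (s.encard : ℝ≥0∞) = ∑' n, s.indicator 1 n := by
  rw [← ENNReal.tsum_set_one, tsum_subtype s (fun _ => (1 : ℝ≥0∞))]
  rfl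

omit [Fintype P] [Fintype ι] in
theorem SelectionRule.count_eq_tsum (a : ι) (s : S) (r : ℕ → ∀ p, E p) :
    σ.count a s r =
      ∑' n, {q : S × (ℕ → ∀ p, E p) | σ.log q.1 q.2 n = some a}.indicator 1 (s, r) := by
  rw [SelectionRule.count, encard_eq_tsum_indicator]
  rfl

omit [Fintype P] in
theorem SelectionRule.measurable_count (a : ι) :
    Measurable fun q : S × (ℕ → ∀ p, E p) => σ.count a q.1 q.2 := by
  simp only [SelectionRule.count_eq_tsum]
  exact Measurable.tsum fun n =>
    measurable_one.indicator (σ.measurableSet_log_eq n (some a))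

omit [Fintype P] in
theorem SelectionRule.totalCount_eq_sum (s : S) (r : ℕ → ∀ p, E p) :
    σ.totalCount s r = ∑ a, σ.count a s r := by
  classical
  simp only [SelectionRule.totalCount, SelectionRule.count, encard_eq_tsum_indicator]
  rw [← Summable.tsum_finsetSum fun _ _ => ENNReal.summable]
  refine tsum_congr fun n => ?_
  cases h : σ.log s r n <;> simp [h, Set.indicator_apply]

include hA in
theorem lintegral_count_le {y : ι → ℝ≥0∞}
    (hy : ∀ i, Measure.pi m (A i) *
      ∏ j ∈ closedNbhd (lopsidependencyGraph A) {i}, (1 + y j) ≤ y i) (a : ι) :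
    ∫⁻ q, σ.count a q.1 q.2 ∂(sampleLaw m ν) ≤ y a := by
  simp only [SelectionRule.count_eq_tsum]
  rw [lintegral_tsum fun n =>
    (measurable_one.indicator (σ.measurableSet_log_eq n (some a))).aemeasurable]
  simp only [lintegral_indicator_one (σ.measurableSet_log_eq _ (some a))]
  rw [ENNReal.tsum_eq_iSup_nat]
  refine iSup_le fun n => ?_
  exact (le_self_add.trans (sum_measure_log_eq_add_le m hA σ ν a n 0)).trans
    (lintegral_potential_le m hA hy a _)

include hA in
theorem lintegral_totalCount_le {y : ι → ℝ≥0∞}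
    (hy : ∀ i, Measure.pi m (A i) *
      ∏ j ∈ closedNbhd (lopsidependencyGraph A) {i}, (1 + y j) ≤ y i) :
    ∫⁻ q, σ.totalCount q.1 q.2 ∂(sampleLaw m ν) ≤ ∑ a, y a := by
  simp only [SelectionRule.totalCount_eq_sum]
  rw [lintegral_finsetSum _ fun a _ => σ.measurable_count a]
  exact Finset.sum_le_sum fun a _ => lintegral_count_le m hA σ ν hy a

include hA in
theorem ae_exists_eval_notMem {y : ι → ℝ≥0∞}
    (hy : ∀ i, Measure.pi m (A i) *
      ∏ j ∈ closedNbhd (lopsidependencyGraph A) {i}, (1 + y j) ≤ y i) (hfin : ∀ i, y i ≠ ∞) :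
    ∀ᵐ q ∂(sampleLaw m ν), ∃ n, ∀ a, σ.eval q.1 q.2 n ∉ A a := by
  have hmeas : Measurable fun q : S × (ℕ → ∀ p, E p) => σ.totalCount q.1 q.2 := by
    simp only [SelectionRule.totalCount_eq_sum]
    exact Finset.measurable_sum _ fun a _ => σ.measurable_count a
  have hlt := ae_lt_top hmeas ((lintegral_totalCount_le m hA σ ν hy).trans_lt
    (ENNReal.sum_lt_top.2 fun i _ => (hfin i).lt_top)).ne
  filter_upwards [hlt] with q hq
  by_contra! hcon
  have huniv : {n : ℕ | σ.log q.1 q.2 n ≠ none} = Set.univ := by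
    refine Set.eq_univ_of_forall fun n hn => ?_
    obtain ⟨a, ha⟩ := hcon n
    exact σ.eval_notMem_of_log_eq_none hn a ha
  rw [SelectionRule.totalCount, huniv, Set.encard_univ] at hq
  simp at hq

include hA in
/-- The evaluation after any number of steps has a law that is absolutely continuous with respect to
the law of the variables. -/
theorem lintegral_eval_eq_zero {g : (∀ p, E p) → ℝ≥0∞} (hg : Measurable g)
    (h0 : ∫⁻ v, g v ∂(Measure.pi m) = 0) (n : ℕ) :
    ∫⁻ q, g (σ.eval q.1 q.2 n) ∂(sampleLaw m ν) = 0 := by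
  induction n generalizing g with
  | zero => rw [lintegral_eval_zero m σ ν hg, h0]
  | succ n ih =>
    rw [lintegral_eval_succ m σ ν hg, ← nonpos_iff_eq_zero]
    set K : ι → MeasurableWeight E := fun a => violationOp (Measure.pi m) (hA a) ⟨g, hg⟩ with hK
    have hmeas : ∀ a, Measurable fun q : S × (ℕ → ∀ p, E p) => (K a).1 (σ.eval q.1 q.2 n) :=
      fun a => (K a).2.comp (σ.measurable_eval n)
    -- Summing over all events removes the dependence on the selection. Each summand is again a
    -- function with integral zero, to which the induction hypothesis applies.
    calc _ ≤ ∫⁻ q, (g (σ.eval q.1 q.2 n) + ∑ a, (K a).1 (σ.eval q.1 q.2 n))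
          ∂(sampleLaw m ν) := by
          refine lintegral_mono fun q => ?_
          cases h : σ.log q.1 q.2 n with
          | none => exact le_self_add
          | some f =>
            refine le_add_left (le_trans ?_ (Finset.single_le_sum
              (f := fun a => (K a).1 (σ.eval q.1 q.2 n)) (fun _ _ => zero_le)
              (Finset.mem_univ f)))
            simp [hK, violationOp_apply, resample_eq_resampleOn, σ.eval_mem_of_log_eq_some h]
      _ = 0 := by
          have hgn : Measurable fun q : S × (ℕ → ∀ p, E p) => g (σ.eval q.1 q.2 n) :=
            hg.comp (σ.measurable_eval n)
          rw [lintegral_add_left hgn,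
            lintegral_finsetSum _ fun a _ => hmeas a, ih hg h0, zero_add]
          refine Finset.sum_eq_zero fun a _ => ih (K a).2 ?_
          rw [hK, lintegral_violationOp, h0, mul_zero]

/-- The rule that selects the first violated event in some fixed order. -/
noncomputable def firstViolated : SelectionRule A Unit where
  pick _ n h := by
    classical exact (Finset.univ : Finset ι).toList.find? fun a => decide (h (Fin.last n) ∈ A a)
  violated_of_pick _ n h a ha := by
    simpa using List.find?_some ha
  not_violated_of_pick _ n h hn a := by
    simpa using List.find?_eq_none.1 hn a (by simp)
  measurableSet_pick n a := by
    classical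
    generalize (Finset.univ : Finset ι).toList = l
    have hlast : ∀ b, MeasurableSet {q : Unit × (Fin (n + 1) → ∀ p, E p) |
        q.2 (Fin.last n) ∈ A b} := fun b =>
      ((measurable_pi_apply (Fin.last n)).comp measurable_snd) (hA b)
    induction l with
    | nil => simp
    | cons b l ih =>
      have : {q : Unit × (Fin (n + 1) → ∀ p, E p) |
          (b :: l).find? (fun a => decide (q.2 (Fin.last n) ∈ A a)) = some a} =
          ({q | q.2 (Fin.last n) ∈ A b} ∩ {_q | b = a}) ∪
          ({q | q.2 (Fin.last n) ∈ A b}ᶜ ∩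
            {q | l.find? (fun a => decide (q.2 (Fin.last n) ∈ A a)) = some a}) := by
        ext q
        by_cases hb : q.2 (Fin.last n) ∈ A b <;> simp [List.find?_cons, hb]
      rw [this]
      exact ((hlast b).inter (MeasurableSet.const _)).union ((hlast b).compl.inter ih)

-- Were this set null, no evaluation of the algorithm would almost surely ever lie in it,
-- contradicting termination; any selection rule would do, and `firstViolated` supplies one.
include hA in
theorem pi_setOf_forall_notMem_ne_zero {y : ι → ℝ≥0∞}
    (hy : ∀ i, Measure.pi m (A i) *
      ∏ j ∈ closedNbhd (lopsidependencyGraph A) {i}, (1 + y j) ≤ y i) (hfin : ∀ i, y i ≠ ∞) :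
    Measure.pi m {v | ∀ a, v ∉ A a} ≠ 0 := by
  intro h0
  have hgood : MeasurableSet {v : ∀ p, E p | ∀ a, v ∉ A a} := by
    simp only [Set.ofPred_forall]
    exact MeasurableSet.iInter fun a => (hA a).compl
  have hnone : ∀ᵐ q ∂(sampleLaw m (Measure.dirac ())), ∀ n,
      (firstViolated hA).eval q.1 q.2 n ∉ {v : ∀ p, E p | ∀ a, v ∉ A a} := by
    refine ae_all_iff.2 fun n => ?_
    have hg : Measurable ({v : ∀ p, E p | ∀ a, v ∉ A a}.indicator (1 : (∀ p, E p) → ℝ≥0∞)) :=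
      measurable_one.indicator hgood
    have := lintegral_eval_eq_zero m hA (firstViolated hA) (Measure.dirac ()) hg
      (by rw [lintegral_indicator_one hgood, h0]) n
    filter_upwards [(lintegral_eq_zero_iff
      (hg.comp ((firstViolated hA).measurable_eval n))).1 this] with q hq hmem
    obtain ⟨a, ha⟩ : ∃ a, (firstViolated hA).eval q.1 q.2 n ∈ A a := by simpa using hq
    exact hmem a ha
  have hfalse : ∀ᵐ _q ∂(sampleLaw m (Measure.dirac ())), False := by
    filter_upwards [hnone,
      ae_exists_eval_notMem m hA (firstViolated hA) (Measure.dirac ()) hy hfin] with q hq hq'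
    obtain ⟨n, hn⟩ := hq'
    exact hq n hn
  rw [Filter.eventually_false_iff_eq_bot, ae_eq_bot] at hfalse
  exact IsProbabilityMeasure.ne_zero _ hfalse

end Expectation

/-! ### From the assignment `x` to the weights `x / (1 - x)` -/

theorem closedNbhd_singleton {P : Type*} {E : P → Type*} {ι : Type*} [Fintype ι] [DecidableEq ι]
    (A : ι → Set (∀ p, E p)) (i : ι) :
    closedNbhd (lopsidependencyGraph A) {i} = insert i (lopsiNeighbors A i) := by
  ext j
  simp [mem_closedNbhd, Touches, lopsiNeighbors, SimpleGraph.adj_comm]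

/-- Since `1 + x / (1 - x) = (1 - x)⁻¹`, the neighbours cancel the product in `ht`, and the vertex
`i` itself contributes the denominator `1 - x i`. -/
theorem mul_prod_closedNbhd_le {P : Type*} {E : P → Type*} {ι : Type*} [Fintype ι]
    (A : ι → Set (∀ p, E p)) {x : ι → ℝ} (hx : ∀ a, x a ∈ Set.Ioo (0 : ℝ) 1) {i : ι} {t : ℝ}
    (ht : t ≤ x i * ∏ b ∈ lopsiNeighbors A i, (1 - x b)) :
    ENNReal.ofReal t * ∏ j ∈ closedNbhd (lopsidependencyGraph A) {i},
      (1 + ENNReal.ofReal (x j / (1 - x j))) ≤ ENNReal.ofReal (x i / (1 - x i)) := by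
  classical
  have hpos : ∀ j, 0 < 1 - x j := fun j => sub_pos.2 (hx j).2
  have hone : ∀ j, 1 + ENNReal.ofReal (x j / (1 - x j)) = ENNReal.ofReal (1 - x j)⁻¹ := by
    intro j
    rw [← ENNReal.ofReal_one, ← ENNReal.ofReal_add zero_le_one
      (div_nonneg (hx j).1.le (hpos j).le)]
    congr 1
    have := (hpos j).ne'
    field_simp
    ring
  have hi : i ∉ lopsiNeighbors A i := by simp [lopsiNeighbors]
  have hprod : 0 < ∏ b ∈ lopsiNeighbors A i, (1 - x b) := Finset.prod_pos fun b _ => hpos b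
  simp only [hone]
  rw [← ENNReal.ofReal_prod_of_nonneg fun j _ => (inv_pos.2 (hpos j)).le,
    closedNbhd_singleton, Finset.prod_insert hi, Finset.prod_inv_distrib,
    ← ENNReal.ofReal_mul' (mul_pos (inv_pos.2 (hpos i)) (inv_pos.2 hprod)).le]
  refine ENNReal.ofReal_le_ofReal ?_
  refine (mul_le_mul_of_nonneg_right ht
    (mul_pos (inv_pos.2 (hpos i)) (inv_pos.2 hprod)).le).trans_eq ?_
  have := (hpos i).ne'
  field_simp

end LovaszLocal

theorem theorem5
    {P : Type*} [Fintype P] {E : P → Type*} [∀ p, MeasurableSpace (E p)]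
    {Ω : Type*} [MeasurableSpace Ω] (μ : Measure Ω) [IsProbabilityMeasure μ]
    (X : ∀ p, Ω → E p) (hX : ∀ p, Measurable (X p)) (hindep : iIndepFun X μ)
    {ι : Type*} [Fintype ι] (A : ι → Set (∀ p, E p)) (hA : ∀ a, MeasurableSet (A a))
    (x : ι → ℝ) (hx : ∀ a, x a ∈ Set.Ioo (0 : ℝ) 1)
    (hprob : ∀ a, μ.real {ω | (fun p => X p ω) ∈ A a} ≤
      x a * ∏ b ∈ LovaszLocal.lopsiNeighbors A a, (1 - x b)) :
    -- some evaluation, taken by the variables at some outcome, violates none of the events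
    (∃ v ∈ Set.range (fun ω p => X p ω), ∀ a, v ∉ A a) ∧
    -- the sequential algorithm, with any procedure for the selection of violated events
    ∀ (S : Type*) [MeasurableSpace S] (ν : Measure S) [IsProbabilityMeasure ν]
      (σ : LovaszLocal.SelectionRule A S),
      -- it finds such an evaluation almost surely
      (∀ᵐ q ∂(LovaszLocal.randomSource ν μ X), ∃ n, ∀ a, σ.eval q.1 q.2 n ∉ A a) ∧
      -- expected number of resamplings of each event
      (∀ a, ∫⁻ q, σ.count a q.1 q.2 ∂(LovaszLocal.randomSource ν μ X) ≤
        ENNReal.ofReal (x a / (1 - x a))) ∧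
      -- expected total number of resampling steps
      ∫⁻ q, σ.totalCount q.1 q.2 ∂(LovaszLocal.randomSource ν μ X) ≤
        ENNReal.ofReal (∑ a, x a / (1 - x a)) := by
  have hlaw : ∀ p, IsProbabilityMeasure (μ.map (X p)) := fun p =>
    Measure.isProbabilityMeasure_map (hX p).aemeasurable
  have hmap := (iIndepFun_iff_map_fun_eq_pi_map fun p => (hX p).aemeasurable).1 hindep
  have hXm : Measurable fun ω p => X p ω := measurable_pi_lambda _ hX
  have hy : ∀ i, Measure.pi (fun p => μ.map (X p)) (A i) *
      ∏ j ∈ LovaszLocal.closedNbhd (LovaszLocal.lopsidependencyGraph A) {i},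
        (1 + ENNReal.ofReal (x j / (1 - x j))) ≤ ENNReal.ofReal (x i / (1 - x i)) := by
    intro i
    have hi := LovaszLocal.mul_prod_closedNbhd_le A hx (hprob i)
    rw [ofReal_measureReal] at hi
    rwa [← hmap, Measure.map_apply hXm (hA i)]
  refine ⟨?_, fun S _ ν _ σ => ⟨?_, fun a => ?_, ?_⟩⟩
  -- Good evaluations have positive probability under the joint law of the variables, so one is
  -- attained at some outcome.
  · by_contra! hcon
    refine LovaszLocal.pi_setOf_forall_notMem_ne_zero (fun p => μ.map (X p)) hA hy
      (fun _ => ENNReal.ofReal_ne_top) ?_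
    have hgood : MeasurableSet {v : ∀ p, E p | ∀ a, v ∉ A a} := by
      simp only [Set.ofPred_forall]
      exact MeasurableSet.iInter fun a => (hA a).compl
    rw [← hmap, Measure.map_apply hXm hgood]
    have hempty : (fun ω p => X p ω) ⁻¹' {v | ∀ a, v ∉ A a} = ∅ := by
      refine Set.eq_empty_of_forall_notMem fun ω hω => ?_
      obtain ⟨a, ha⟩ := hcon _ ⟨ω, rfl⟩
      exact hω a ha
    rw [hempty, measure_empty]
  · exact LovaszLocal.ae_exists_eval_notMem (fun p => μ.map (X p)) hA σ ν hy
      fun _ => ENNReal.ofReal_ne_top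
  · exact LovaszLocal.lintegral_count_le (fun p => μ.map (X p)) hA σ ν hy a
  · rw [ENNReal.ofReal_sum_of_nonneg fun a _ =>
      div_nonneg (hx a).1.le (sub_pos.2 (hx a).2).le]
    exact LovaszLocal.lintegral_totalCount_le (fun p => μ.map (X p)) hA σ ν hy
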